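/- Let $N \ge n \ge 1$ be integers, let $G$ be an $n \times N$ random matrix whose entries are i.i.d. (circularly symmetric) complex Gaussian random variables with mean $0$ and variance $\mathbb{E}|G_{ij}|^2 = 1/n$, that is, with independent real and imaginary parts, each real Gaussian with mean $0$ and variance $1/(2n)$. Let $R_D \in \mathbb{C}^{n \times N}$ be deterministic, and let $R = R_D + G$. Denote by $\sigma_1(R) \ge \dots \ge \sigma_n(R) \ge 0$ the singular values of $R$. Then, for every $\tau > 0$, \[ \mathbb{P}\left(\sigma_n(R) \le \tau\right) \le \frac{\tau^{2(N-n+1)}}{\sqrt{2\pi}} \cdot \frac{(nNe^2)^{N-n+1}}{(N-n+1)^{2(N-n+1)+1/2}}. \] -/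

import Mathlib

open MeasureTheory ProbabilityTheory
open scoped NNReal

/-- The circularly symmetric complex Gaussian law with mean `0` and variance `E |X| ^ 2 = v`:
the law of `X = x + i y` with `x`, `y` independent real Gaussians of mean `0`, variance `v / 2`. -/
noncomputable def complexGaussian (v : ℝ≥0) : Measure ℂ :=
  ((gaussianReal 0 (v / 2)).prod (gaussianReal 0 (v / 2))).map
    (fun p : ℝ × ℝ => (⟨p.1, p.2⟩ : ℂ))

/-- The `k`-th largest singular value `σ_k(A)` of a complex matrix, for `k ≥ 1`, counted with
multiplicity, so that `σ_1(A)` is the spectral norm. (Mathlib's sequence of singular values is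
indexed from `0`.) -/
noncomputable def matrixSingularValue {m n : ℕ} (A : Matrix (Fin m) (Fin n) ℂ) (k : ℕ) : ℝ :=
  (Matrix.toEuclideanLin A).singularValues (k - 1)

/-!
Write `k = N - n + 1`, and let `τ` bound `σ_n(R)`. Then some unit vector `u` satisfies
`‖uᵀ R‖ ≤ τ` (`exists_sum_norm_sq_le_matrixSingularValue`). The proof combines two observations.

* Fix a direction `g ≠ 0` in `ℂ ^ n` and `0 < α < 1`. That such a `u` exists with squared component
  at least `α` along `g` has probability at most `(n τ ^ 2 / α) ^ k / k!`
  (`pi_complexGaussian_large_component_le`). The law of `G` is invariant under unitary matrices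
  acting on the rows, so `g` may be taken to be a coordinate axis. Then one row of `R` lies within
  `τ / √α` of the span of the other `n - 1` rows. Given those, the row is a shifted Gaussian vector
  whose projection to some `k`-dimensional space has norm at most `τ / √α`; its density there is at
  most `(n / π) ^ k`, and the ball has volume `π ^ k (τ / √α) ^ (2 k) / k!`.
* A Gaussian direction `g` independent of `R` has squared component at least `α` along a given unit
  vector `u` with probability `(1 - α) ^ (n - 1)` (`ofReal_le_pi_complexGaussian_component`).

Fubini's theorem (`pi_complexGaussian_exists_unit_le`) gives
`(1 - α) ^ (n - 1) * ℙ(σ_n(R) ≤ τ) ≤ (n τ ^ 2 / α) ^ k / k!`. At the optimal `α = k / N` one has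
`(1 - α) ^ (n - 1) ≥ exp (-k)`, and Stirling's lower bound for `k!` concludes.

Unitary invariance (`measurePreserving_pi_complexGaussian`) is read off from the density, which
depends on the Euclidean norm only.
-/

open scoped ENNReal

/-! ### The complex Gaussian law -/

/-- The Lebesgue density of `complexGaussian v`, for `v ≠ 0`. -/
noncomputable def complexGaussianPDFReal (v : ℝ≥0) (z : ℂ) : ℝ :=
  (Real.pi * v)⁻¹ * Real.exp (-‖z‖ ^ 2 / v)

lemma complexGaussianPDFReal_nonneg (v : ℝ≥0) (z : ℂ) : 0 ≤ complexGaussianPDFReal v z := by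
  unfold complexGaussianPDFReal; positivity

@[fun_prop]
lemma continuous_complexGaussianPDFReal (v : ℝ≥0) : Continuous (complexGaussianPDFReal v) := by
  unfold complexGaussianPDFReal; fun_prop

instance isProbabilityMeasure_complexGaussian (v : ℝ≥0) :
    IsProbabilityMeasure (complexGaussian v) :=
  Measure.isProbabilityMeasure_map
    Complex.measurableEquivRealProd.symm.measurable.aemeasurable

lemma complexGaussian_eq_withDensity {v : ℝ≥0} (hv : v ≠ 0) :
    complexGaussian v =
      volume.withDensity (fun z => ENNReal.ofReal (complexGaussianPDFReal v z)) := by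
  have hv2 : v / 2 ≠ 0 := by positivity
  have hmap : (fun p : ℝ × ℝ => (⟨p.1, p.2⟩ : ℂ)) = Complex.measurableEquivRealProd.symm := rfl
  have hvol := Complex.volume_preserving_equiv_real_prod.symm
  ext s hs
  rw [complexGaussian, hmap, gaussianReal_of_var_ne_zero 0 hv2,
    prod_withDensity (measurable_gaussianPDF _ _) (measurable_gaussianPDF _ _),
    MeasurableEquiv.map_apply, withDensity_apply _ (MeasurableEquiv.measurable _ hs),
    withDensity_apply _ hs, ← hvol.setLIntegral_comp_preimage hs (by fun_prop)]
  refine lintegral_congr fun p => ?_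
  have hv' : (0 : ℝ) < v := by positivity
  rw [gaussianPDF, gaussianPDF, ← ENNReal.ofReal_mul (gaussianPDFReal_nonneg _ _ _),
    gaussianPDFReal, gaussianPDFReal, complexGaussianPDFReal, ← Complex.normSq_eq_norm_sq,
    Complex.normSq_apply]
  congr 1
  have h2 : (2 : ℝ) * Real.pi * ((v / 2 : ℝ≥0) : ℝ) = Real.pi * v := by
    push_cast; ring
  rw [h2, mul_mul_mul_comm, ← Real.exp_add, ← mul_inv, Real.mul_self_sqrt (by positivity)]
  congr 2
  simp only [Complex.measurableEquivRealProd_symm_apply]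
  push_cast
  field_simp
  ring

lemma integrable_complexGaussianPDFReal {v : ℝ≥0} (hv : v ≠ 0) :
    Integrable (complexGaussianPDFReal v) := by
  refine ⟨by fun_prop, ?_⟩
  rw [hasFiniteIntegral_iff_ofReal (ae_of_all _ (complexGaussianPDFReal_nonneg v))]
  have h := measure_univ (μ := complexGaussian v)
  rw [complexGaussian_eq_withDensity hv, withDensity_apply _ MeasurableSet.univ,
    Measure.restrict_univ] at h
  simp [h]

/-! ### Vectors of independent complex Gaussians -/

section Pi

variable {ι : Type*} [Fintype ι]

lemma prod_complexGaussianPDFReal (v : ℝ≥0) (x : ι → ℂ) :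
    ∏ i, complexGaussianPDFReal v (x i) =
      (Real.pi * v)⁻¹ ^ Fintype.card ι * Real.exp (-(∑ i, ‖x i‖ ^ 2) / v) := by
  simp only [complexGaussianPDFReal, Finset.prod_mul_distrib, Finset.prod_const, Finset.card_univ,
    ← Real.exp_sum, ← Finset.sum_div, Finset.sum_neg_distrib]

/-- The density of a vector of independent complex Gaussians depends only on its Euclidean
norm. -/
lemma pi_complexGaussian_eq_withDensity {v : ℝ≥0} (hv : v ≠ 0) :
    Measure.pi (fun _ : ι => complexGaussian v) = volume.withDensity (fun x => ENNReal.ofReal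
      ((Real.pi * v)⁻¹ ^ Fintype.card ι * Real.exp (-(∑ i, ‖x i‖ ^ 2) / v))) := by
  simp_rw [← prod_complexGaussianPDFReal]
  refine Measure.pi_eq fun s hs => ?_
  rw [withDensity_apply _ (MeasurableSet.univ_pi hs), volume_pi, Measure.restrict_pi_pi,
    ← ofReal_integral_eq_lintegral_ofReal, integral_fintype_prod_eq_prod,
    ENNReal.ofReal_prod_of_nonneg]
  · refine Finset.prod_congr rfl fun i _ => ?_
    rw [complexGaussian_eq_withDensity hv, withDensity_apply _ (hs i),
      ofReal_integral_eq_lintegral_ofReal (integrable_complexGaussianPDFReal hv).integrableOn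
        (ae_of_all _ (complexGaussianPDFReal_nonneg v))]
  · exact fun i _ => integral_nonneg (complexGaussianPDFReal_nonneg v)
  · exact Integrable.fintype_prod (μ := fun i => (volume : Measure ℂ).restrict (s i))
      fun i => (integrable_complexGaussianPDFReal hv).integrableOn
  · exact ae_of_all _ fun x => Finset.prod_nonneg fun i _ => complexGaussianPDFReal_nonneg v _

/-- Unitary invariance. The image of Lebesgue measure under the map is a multiple of
Lebesgue measure, so the image of the Gaussian is a multiple of the Gaussian; both have mass `1`. -/
lemma measurePreserving_pi_complexGaussian {v : ℝ≥0} (hv : v ≠ 0) (f : (ι → ℂ) →ₗ[ℂ] (ι → ℂ))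
    (hf : ∀ x, ∑ i, ‖f x i‖ ^ 2 = ∑ i, ‖x i‖ ^ 2) :
    MeasurePreserving f (Measure.pi fun _ : ι => complexGaussian v)
      (Measure.pi fun _ : ι => complexGaussian v) := by
  have hinj : Function.Injective f := by
    rw [injective_iff_map_eq_zero]
    intro x hx
    have h := hf x
    rw [hx] at h
    simp only [Pi.zero_apply, norm_zero, ne_eq, OfNat.ofNat_ne_zero, not_false_eq_true, zero_pow,
      Finset.sum_const_zero] at h
    rw [eq_comm, Finset.sum_eq_zero_iff_of_nonneg (fun _ _ => by positivity)] at h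
    funext i
    simpa using h i (Finset.mem_univ i)
  have hdet : LinearMap.det (f.restrictScalars ℝ) ≠ 0 := by
    rw [← isUnit_iff_ne_zero, ← LinearMap.isUnit_iff_isUnit_det, LinearMap.isUnit_iff_ker_eq_bot]
    exact LinearMap.ker_eq_bot.2 hinj
  have hcont : Continuous f := f.continuous_of_finiteDimensional
  have hmeas : Measurable f := hcont.measurable
  have hvol := Measure.map_linearMap_addHaar_eq_smul_addHaar
    (volume : Measure (ι → ℂ)) hdet
  set c := ENNReal.ofReal |(LinearMap.det (f.restrictScalars ℝ))⁻¹|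
  have hmap : (Measure.pi fun _ : ι => complexGaussian v).map f =
      c • Measure.pi fun _ : ι => complexGaussian v := by
    ext s hs
    rw [Measure.map_apply hmeas hs, pi_complexGaussian_eq_withDensity hv,
      withDensity_apply _ (hmeas hs), Measure.smul_apply, withDensity_apply _ hs,
      ← lintegral_smul_measure, ← Measure.restrict_smul]
    erw [← hvol]
    rw [setLIntegral_map hs (by fun_prop) (by exact hmeas)]
    simp [hf]
  refine ⟨hmeas, ?_⟩
  have h1 : ((Measure.pi fun _ : ι => complexGaussian v).map f) Set.univ = 1 := by
    rw [Measure.map_apply hmeas MeasurableSet.univ]; simp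
  rw [hmap] at h1
  have hc : c = 1 := by simpa using h1
  rw [hmap, hc, one_smul]

/-- The tail of `|z| ^ 2`, an exponential random variable. -/
lemma ofReal_exp_le_complexGaussian {v : ℝ≥0} (hv : v ≠ 0) {x : ℝ} (hx : 0 ≤ x) :
    ENNReal.ofReal (Real.exp (-x / v)) ≤ complexGaussian v {z | x ≤ ‖z‖ ^ 2} := by
  have hv' : (0 : ℝ) < v := by positivity
  have hms : MeasurableSet {z : ℂ | x ≤ ‖z‖ ^ 2} := measurableSet_le (by fun_prop) (by fun_prop)
  rw [complexGaussian_eq_withDensity hv, withDensity_apply _ hms,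
    ← ofReal_integral_eq_lintegral_ofReal (integrable_complexGaussianPDFReal hv).integrableOn
        (ae_of_all _ (complexGaussianPDFReal_nonneg v))]
  refine ENNReal.ofReal_le_ofReal (le_of_eq ?_)
  have hrad := integral_fun_norm_addHaar (volume : Measure ℂ)
    (Set.indicator (Set.Ici (√x)) fun r : ℝ => (Real.pi * v)⁻¹ * Real.exp (-r ^ 2 / v))
  have hL : (∫ z : ℂ, Set.indicator (Set.Ici (√x))
      (fun r : ℝ => (Real.pi * v)⁻¹ * Real.exp (-r ^ 2 / v)) ‖z‖) =
      ∫ z in {z : ℂ | x ≤ ‖z‖ ^ 2}, complexGaussianPDFReal v z := by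
    rw [← integral_indicator hms]
    congr 1 with z
    simp only [Set.indicator, Set.mem_Ici, Set.mem_ofPred_eq, complexGaussianPDFReal,
      Real.sqrt_le_left (norm_nonneg z)]
  have hball : (volume : Measure ℂ).real (Metric.ball 0 1) = Real.pi := by
    simp [Measure.real, Complex.volume_ball]
  have hR : (∫ y in Set.Ioi (0 : ℝ), y ^ (Module.finrank ℝ ℂ - 1) • Set.indicator (Set.Ici (√x))
      (fun r : ℝ => (Real.pi * v)⁻¹ * Real.exp (-r ^ 2 / v)) y) =
      ∫ y in Set.Ioi (√x), (Real.pi * v)⁻¹ * (y * Real.exp (-y ^ 2 / v)) := by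
    have h1 : ∀ y : ℝ, y ^ (Module.finrank ℝ ℂ - 1) • Set.indicator (Set.Ici (√x))
        (fun r : ℝ => (Real.pi * v)⁻¹ * Real.exp (-r ^ 2 / v)) y =
        Set.indicator (Set.Ici (√x))
          (fun y => (Real.pi * v)⁻¹ * (y * Real.exp (-y ^ 2 / v))) y := by
      intro y
      simp only [Complex.finrank_real_complex, Set.indicator]
      split_ifs
      · simp; ring
      · simp
    simp_rw [h1]
    rw [← integral_Ici_eq_integral_Ioi, ← integral_Ici_eq_integral_Ioi,
      setIntegral_indicator measurableSet_Ici, Set.inter_eq_right.2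
      (Set.Ici_subset_Ici.2 (Real.sqrt_nonneg x))]
  have hI : ∫ y in Set.Ioi (√x), (Real.pi * v)⁻¹ * (y * Real.exp (-y ^ 2 / v)) =
      (2 * Real.pi)⁻¹ * Real.exp (-x / v) := by
    have hder : ∀ y ∈ Set.Ici (√x), HasDerivAt
        (fun y : ℝ => -((2 * Real.pi)⁻¹ * Real.exp (-y ^ 2 / v)))
        ((Real.pi * v)⁻¹ * (y * Real.exp (-y ^ 2 / v))) y := by
      intro y _
      have h := (((((hasDerivAt_id y).pow 2).neg).div_const (v : ℝ)).exp.const_mul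
        ((2 * Real.pi)⁻¹)).neg
      refine h.congr_deriv ?_
      simp
      field_simp
    have hlim : Filter.Tendsto (fun y : ℝ => -((2 * Real.pi)⁻¹ * Real.exp (-y ^ 2 / v)))
        Filter.atTop (nhds (-((2 * Real.pi)⁻¹ * 0))) := by
      refine (Filter.Tendsto.const_mul _ (Real.tendsto_exp_atBot.comp ?_)).neg
      refine Filter.Tendsto.atBot_div_const hv' ?_
      exact Filter.tendsto_neg_atTop_atBot.comp (Filter.tendsto_pow_atTop (by norm_num))
    rw [integral_Ioi_of_hasDerivAt_of_nonneg' hder _ hlim, Real.sq_sqrt hx]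
    · ring
    · intro y hy
      have : 0 ≤ y := (Real.sqrt_nonneg x).trans (le_of_lt hy)
      positivity
  rw [← hL, hrad, hR, hI, hball, Complex.finrank_real_complex]
  simp
  field_simp

/-- The Laplace transform of the squared norm of a Gaussian vector. The integrand times the
density is again a multiple of a Gaussian density, with variance `v / (1 + β)`. -/
lemma lintegral_exp_pi_complexGaussian {v : ℝ≥0} (hv : v ≠ 0) (β : ℝ≥0) :
    ∫⁻ x, ENNReal.ofReal (Real.exp (-(β * ∑ i, ‖x i‖ ^ 2) / v))
        ∂(Measure.pi fun _ : ι => complexGaussian v) =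
      ENNReal.ofReal ((1 + β : ℝ)⁻¹ ^ Fintype.card ι) := by
  have hv' : (0 : ℝ) < v := by positivity
  have hw : v / (1 + β) ≠ 0 := by positivity
  have h1 := measure_univ (μ := Measure.pi fun _ : ι => complexGaussian (v / (1 + β)))
  rw [pi_complexGaussian_eq_withDensity hw, withDensity_apply _ MeasurableSet.univ,
    Measure.restrict_univ] at h1
  rw [pi_complexGaussian_eq_withDensity hv, lintegral_withDensity_eq_lintegral_mul _
    (by fun_prop) (by fun_prop), ← mul_one (ENNReal.ofReal ((1 + β : ℝ)⁻¹ ^ Fintype.card ι)),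
    ← h1, ← lintegral_const_mul _ (by fun_prop)]
  refine lintegral_congr fun x => ?_
  rw [Pi.mul_apply, ← ENNReal.ofReal_mul (by positivity), ← ENNReal.ofReal_mul (by positivity),
    mul_assoc, ← Real.exp_add, ← mul_assoc, ← mul_pow]
  congr 3
  · push_cast
    field_simp
  · push_cast
    field_simp
    ring

/-- The right-hand side is the bound `(π v)⁻¹ ^ k` on the density times the volume of a ball of
radius `√r` in `ℂ ^ k`. -/
lemma pi_complexGaussian_ball_le [Nonempty ι] {v : ℝ≥0} (hv : v ≠ 0) (c : ι → ℂ) {r : ℝ}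
    (hr : 0 ≤ r) :
    Measure.pi (fun _ : ι => complexGaussian v) {x | ∑ i, ‖c i + x i‖ ^ 2 ≤ r} ≤
      ENNReal.ofReal ((r / v) ^ Fintype.card ι / (Fintype.card ι).factorial) := by
  have hv' : (0 : ℝ) < v := by positivity
  have hms : MeasurableSet {x : ι → ℂ | ∑ i, ‖c i + x i‖ ^ 2 ≤ r} :=
    measurableSet_le (by fun_prop) (by fun_prop)
  have hvol : volume {x : ι → ℂ | ∑ i, ‖c i + x i‖ ^ 2 ≤ r} =
      ENNReal.ofReal ((Real.pi * r) ^ Fintype.card ι / (Fintype.card ι).factorial) := by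
    have h := Complex.volume_sum_rpow_le ι (p := 2) (by norm_num) (√r)
    have hset : {x : ι → ℂ | ∑ i, ‖c i + x i‖ ^ 2 ≤ r} =
        (fun x => c + x) ⁻¹' {x : ι → ℂ | (∑ i, ‖x i‖ ^ (2 : ℝ)) ^ (1 / (2 : ℝ)) ≤ √r} := by
      ext x
      simp only [Set.mem_ofPred_eq, Set.mem_preimage, ← Real.sqrt_eq_rpow, Real.rpow_two,
        Pi.add_apply]
      rw [Real.sqrt_le_sqrt_iff hr]
    rw [hset, measure_preimage_add, h, ← ENNReal.ofReal_pow (Real.sqrt_nonneg r),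
      ← ENNReal.ofReal_mul (by positivity), pow_mul, Real.sq_sqrt hr]
    congr 1
    have e1 : (2 : ℝ) / 2 + 1 = 2 := by norm_num
    have e2 : (2 : ℝ) * (Fintype.card ι) / 2 + 1 = (Fintype.card ι) + 1 := by ring
    rw [e1, e2, Real.Gamma_two, Real.Gamma_nat_eq_factorial, mul_one, mul_pow]
    ring
  rw [pi_complexGaussian_eq_withDensity hv, withDensity_apply _ hms]
  calc _ ≤ ∫⁻ _ in {x : ι → ℂ | ∑ i, ‖c i + x i‖ ^ 2 ≤ r},
        ENNReal.ofReal ((Real.pi * v)⁻¹ ^ Fintype.card ι) := by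
        refine lintegral_mono fun x => ENNReal.ofReal_le_ofReal ?_
        refine mul_le_of_le_one_right (by positivity) (Real.exp_le_one_iff.2 ?_)
        rw [neg_div]
        exact neg_nonpos.2 (by positivity)
    _ = _ := by
        rw [setLIntegral_const, hvol, ← ENNReal.ofReal_mul (by positivity)]
        congr 1
        rw [← mul_div_assoc, ← mul_pow]
        congr 2
        field_simp

end Pi

section Marginal
variable {ι : Type*} [Fintype ι]

lemma pi_complexGaussian_coord_ball_le {v : ℝ≥0} (hv : v ≠ 0) (s : Finset ι) (hs : s.Nonempty)
    (c : ι → ℂ) {r : ℝ} (hr : 0 ≤ r) :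
    Measure.pi (fun _ : ι => complexGaussian v) {x | ∑ i ∈ s, ‖c i + x i‖ ^ 2 ≤ r} ≤
      ENNReal.ofReal ((r / v) ^ s.card / s.card.factorial) := by
  classical
  obtain ⟨p, hp⟩ : ∃ p : ι → Prop, ∀ i, i ∈ s ↔ p i := ⟨(· ∈ s), fun _ => Iff.rfl⟩
  have hmp := (measurePreserving_fst (μ := Measure.pi fun _ : {i // p i} => complexGaussian v)
    (ν := Measure.pi fun _ : {i // ¬p i} => complexGaussian v)).comp
    (measurePreserving_piEquivPiSubtypeProd (fun _ : ι => complexGaussian v) p)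
  have : Nonempty {i // p i} := let ⟨i, hi⟩ := hs; ⟨⟨i, (hp i).1 hi⟩⟩
  have h := pi_complexGaussian_ball_le hv (fun i : {i // p i} => c i) hr
  rw [← hmp.measure_preimage (measurableSet_le (by fun_prop) (by fun_prop)).nullMeasurableSet,
    Fintype.card_of_subtype s hp] at h
  refine le_trans (measure_mono fun x hx => ?_) h
  simp only [Set.mem_ofPred_eq] at hx
  rw [Finset.sum_subtype s hp] at hx
  exact hx

end Marginal

/-! ### Unitary matrices and distances to subspaces -/

section Unitary
variable {ι : Type*} [Fintype ι] [DecidableEq ι]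

open Matrix

lemma sum_norm_sq_mulVec_of_mem_unitaryGroup {W : Matrix ι ι ℂ} (hW : W ∈ unitaryGroup ι ℂ)
    (x : ι → ℂ) : ∑ i, ‖(W *ᵥ x) i‖ ^ 2 = ∑ i, ‖x i‖ ^ 2 := by
  have key : ∀ y : ι → ℂ, ((∑ i, ‖y i‖ ^ 2 : ℝ) : ℂ) = star y ⬝ᵥ y := by
    intro y
    simp only [dotProduct, Pi.star_apply, RCLike.star_def, Complex.conj_mul']
    push_cast
    rfl
  have h : star (W *ᵥ x) ⬝ᵥ (W *ᵥ x) = star x ⬝ᵥ x := by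
    rw [star_mulVec, ← dotProduct_mulVec, mulVec_mulVec, ← star_eq_conjTranspose,
      mem_unitaryGroup_iff'.1 hW, one_mulVec]
  exact_mod_cast (key _).trans (h.trans (key x).symm)

/-- An orthonormal basis gives a unitary matrix: its rows are the conjugated basis vectors, so
that it maps a vector to its coordinates. -/
lemma exists_unitary_of_orthonormalBasis (b : OrthonormalBasis ι ℂ (EuclideanSpace ℂ ι)) :
    ∃ W ∈ unitaryGroup ι ℂ, ∀ i j, W i j = star (b i j) := by
  refine ⟨Matrix.of fun i j => star (b i j), ?_, fun _ _ => rfl⟩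
  rw [mem_unitaryGroup_iff]
  ext i l
  have h := orthonormal_iff_ite.1 b.orthonormal i l
  rw [PiLp.inner_apply] at h
  simp only [mul_apply, star_eq_conjTranspose, conjTranspose_apply, of_apply, star_star, one_apply]
  rw [← h]
  refine Finset.sum_congr rfl fun j _ => ?_
  simp [mul_comm]

lemma exists_unitary_row (i₀ : ι) (w : ι → ℂ) (hw : ∑ i, ‖w i‖ ^ 2 = 1) :
    ∃ W ∈ unitaryGroup ι ℂ, ∀ j, W i₀ j = w j := by
  have hon : Orthonormal ℂ (({i₀} : Set ι).domRestrict
      fun _ : ι => (WithLp.toLp 2 (star w) : EuclideanSpace ℂ ι)) := by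
    constructor
    · intro i
      have : ‖(WithLp.toLp 2 (star w) : EuclideanSpace ℂ ι)‖ ^ 2 = 1 := by
        rw [EuclideanSpace.norm_sq_eq]
        simpa using hw
      have h0 := norm_nonneg (WithLp.toLp 2 (star w) : EuclideanSpace ℂ ι)
      change ‖(WithLp.toLp 2 (star w) : EuclideanSpace ℂ ι)‖ = 1
      nlinarith
    · intro i j hij
      exact absurd (Subsingleton.elim i j) hij
  obtain ⟨b, hb⟩ := hon.exists_orthonormalBasis_extension_of_card_eq (by simp)
  obtain ⟨W, hW, h⟩ := exists_unitary_of_orthonormalBasis b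
  refine ⟨W, hW, fun j => ?_⟩
  rw [h, hb i₀ rfl]
  simp

/-- If `r` has at most `card ι - k` rows, then in suitable unitary coordinates `k` of the
coordinates vanish on all of them. -/
lemma exists_unitary_mulVec_eq_zero {κ : Type*} [Fintype κ] (r : κ → ι → ℂ) (k : ℕ)
    (hk : Fintype.card κ + k ≤ Fintype.card ι) :
    ∃ W ∈ unitaryGroup ι ℂ, ∃ s : Finset ι, s.card = k ∧ ∀ l, ∀ i ∈ s, (W *ᵥ r l) i = 0 := by
  let H : Submodule ℂ (EuclideanSpace ℂ ι) :=
    Submodule.span ℂ (Set.range fun l => WithLp.toLp 2 (r l))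
  have hH : Module.finrank ℂ H ≤ Fintype.card κ := finrank_range_le_card _
  have hHo : k ≤ Module.finrank ℂ Hᗮ := by
    have := H.finrank_add_finrank_orthogonal
    rw [finrank_euclideanSpace] at this
    omega
  obtain ⟨s, -, hs⟩ := Finset.exists_subset_card_eq
    (show k ≤ (Finset.univ : Finset ι).card by rw [Finset.card_univ]; omega)
  let e : {i // i ∈ s} → Fin (Module.finrank ℂ Hᗮ) :=
    fun i => Fin.castLE hHo (s.equivFinOfCardEq hs i)
  have he : Function.Injective e :=
    (Fin.castLE_injective hHo).comp (s.equivFinOfCardEq hs).injective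
  let w : ι → EuclideanSpace ℂ ι := fun i =>
    if h : i ∈ s then (stdOrthonormalBasis ℂ Hᗮ (e ⟨i, h⟩) : EuclideanSpace ℂ ι) else 0
  have hw : ∀ i (h : i ∈ s), w i = stdOrthonormalBasis ℂ Hᗮ (e ⟨i, h⟩) := fun i h => dif_pos h
  have hon : Orthonormal ℂ ((s : Set ι).domRestrict w) := by
    have h1 : Orthonormal ℂ fun i => ((stdOrthonormalBasis ℂ Hᗮ (e i) : Hᗮ) : EuclideanSpace ℂ ι) :=
      ((stdOrthonormalBasis ℂ Hᗮ).orthonormal.comp_linearIsometry Hᗮ.subtypeₗᵢ).comp e he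
    have h2 : (s : Set ι).domRestrict w = fun i : {i // i ∈ s} =>
        ((stdOrthonormalBasis ℂ Hᗮ (e i) : Hᗮ) : EuclideanSpace ℂ ι) :=
      funext fun i => hw i i.2
    rw [h2]
    exact h1
  obtain ⟨b, hb⟩ := hon.exists_orthonormalBasis_extension_of_card_eq (by simp)
  obtain ⟨W, hW, h⟩ := exists_unitary_of_orthonormalBasis b
  refine ⟨W, hW, s, hs, fun l i hi => ?_⟩
  have h1 : inner ℂ (b i) (WithLp.toLp 2 (r l)) = 0 := by
    rw [hb i hi, hw i hi]
    exact Submodule.inner_left_of_mem_orthogonal (K := H)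
      (Submodule.subset_span (Set.mem_range_self l)) (Subtype.mem _)
  rw [← h1, PiLp.inner_apply, mulVec, dotProduct]
  refine Finset.sum_congr rfl fun j _ => ?_
  simp [h, mul_comm]

lemma measurePreserving_mulVec_pi_complexGaussian {v : ℝ≥0} (hv : v ≠ 0) {W : Matrix ι ι ℂ}
    (hW : W ∈ unitaryGroup ι ℂ) :
    MeasurePreserving (fun x => W *ᵥ x) (Measure.pi fun _ : ι => complexGaussian v)
      (Measure.pi fun _ : ι => complexGaussian v) :=
  measurePreserving_pi_complexGaussian hv W.mulVecLin
    (sum_norm_sq_mulVec_of_mem_unitaryGroup hW)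

lemma measurePreserving_mul_pi_complexGaussian {κ : Type*} [Fintype κ] {v : ℝ≥0} (hv : v ≠ 0)
    {W : Matrix ι ι ℂ} (hW : W ∈ unitaryGroup ι ℂ) :
    MeasurePreserving (fun (x : ι × κ → ℂ) (p : ι × κ) => ∑ l, W p.1 l * x (l, p.2))
      (Measure.pi fun _ : ι × κ => complexGaussian v)
      (Measure.pi fun _ : ι × κ => complexGaussian v) := by
  refine measurePreserving_pi_complexGaussian hv
    { toFun := fun (x : ι × κ → ℂ) (p : ι × κ) => ∑ l, W p.1 l * x (l, p.2)
      map_add' := fun x y => ?_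
      map_smul' := fun a x => ?_ } fun x => ?_
  · funext p
    simp [mul_add, Finset.sum_add_distrib]
  · funext p
    simp only [Pi.smul_apply, smul_eq_mul, RingHom.id_apply, Finset.mul_sum]
    exact Finset.sum_congr rfl fun l _ => by ring
  · simp only [LinearMap.coe_mk, AddHom.coe_mk, Fintype.sum_prod_type_right]
    exact Finset.sum_congr rfl fun j _ =>
      sum_norm_sq_mulVec_of_mem_unitaryGroup hW fun l => x (l, j)

/-- The probability that a Gaussian vector is within distance `√ρ` of a translate of the span of
`r`, a subspace of codimension at least `k`. -/
lemma pi_complexGaussian_near_span_le {κ : Type*} [Fintype κ] {v : ℝ≥0} (hv : v ≠ 0)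
    (r : κ → ι → ℂ) {k : ℕ} (hk0 : k ≠ 0) (hk : Fintype.card κ + k ≤ Fintype.card ι)
    (c : ι → ℂ) {ρ : ℝ} (hρ : 0 ≤ ρ) :
    Measure.pi (fun _ : ι => complexGaussian v)
        {x | ∃ a : κ → ℂ, ∑ i, ‖c i + x i + ∑ l, a l * r l i‖ ^ 2 ≤ ρ} ≤
      ENNReal.ofReal ((ρ / v) ^ k / k.factorial) := by
  obtain ⟨W, hW, s, hs, hWr⟩ := exists_unitary_mulVec_eq_zero r k hk
  have hsn : s.Nonempty := Finset.card_ne_zero.1 (hs ▸ hk0)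
  have h := pi_complexGaussian_coord_ball_le hv s hsn (W *ᵥ c) hρ
  rw [hs, ← (measurePreserving_mulVec_pi_complexGaussian hv hW).measure_preimage
    (measurableSet_le (by fun_prop) (by fun_prop)).nullMeasurableSet] at h
  refine le_trans (measure_mono ?_) h
  rintro x ⟨a, ha⟩
  have e : (fun i => c i + x i + ∑ l, a l * r l i) = c + x + ∑ l, a l • r l := by
    funext i; simp
  rw [← sum_norm_sq_mulVec_of_mem_unitaryGroup hW, e] at ha
  refine le_trans (le_trans (le_of_eq ?_)
    (Finset.sum_le_univ_sum_of_nonneg (s := s) fun i => by positivity)) ha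
  refine Finset.sum_congr rfl fun i hi => ?_
  have h0 : (W *ᵥ ∑ l, a l • r l) i = 0 := by
    rw [mulVec_sum, Finset.sum_apply]
    refine Finset.sum_eq_zero fun l _ => ?_
    rw [mulVec_smul, Pi.smul_apply, hWr l i hi, smul_zero]
  rw [mulVec_add, mulVec_add, Pi.add_apply, Pi.add_apply, h0, add_zero]

end Unitary

/-! ### The smallest singular value and short combinations of rows -/

section SingularValues

open Module InnerProductSpace

/-- A dimension count: the eigenvectors of `T* T` with index at least `i` and the range of `T*`
have a common nonzero vector `w = T* u`, and `‖T* u‖ ^ 2 = ⟪u, T w⟫ ≤ σ_i ‖u‖ ‖w‖`. -/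
lemma exists_norm_adjoint_le_singularValues {E F : Type*} [NormedAddCommGroup E]
    [InnerProductSpace ℂ E] [FiniteDimensional ℂ E] [NormedAddCommGroup F] [InnerProductSpace ℂ F]
    [FiniteDimensional ℂ F] (T : E →ₗ[ℂ] F) (i : ℕ) (hiF : i < finrank ℂ F)
    (hFE : finrank ℂ F ≤ finrank ℂ E) :
    ∃ u : F, ‖u‖ = 1 ∧ ‖LinearMap.adjoint T u‖ ≤ T.singularValues i := by
  suffices h : ∃ u : F, u ≠ 0 ∧ ‖LinearMap.adjoint T u‖ ≤ T.singularValues i * ‖u‖ by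
    obtain ⟨u, hu, h⟩ := h
    have hu' : 0 < ‖u‖ := norm_pos_iff.2 hu
    refine ⟨(‖u‖⁻¹ : ℂ) • u, ?_, ?_⟩
    · rw [norm_smul, norm_inv, Complex.norm_real, norm_norm, inv_mul_cancel₀ hu'.ne']
    · rw [map_smul, norm_smul, norm_inv, Complex.norm_real, norm_norm, inv_mul_le_iff₀ hu',
        mul_comm]
      exact h
  by_cases hinj : Function.Injective (LinearMap.adjoint T)
  swap
  · rw [injective_iff_map_eq_zero] at hinj
    push Not at hinj
    obtain ⟨u, h0, hu⟩ := hinj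
    refine ⟨u, hu, ?_⟩
    rw [h0, norm_zero]
    exact mul_nonneg (T.singularValues_nonneg i) (norm_nonneg u)
  set b := T.isSymmetric_adjoint_comp_self.eigenvectorBasis rfl
  let J : Type := {j : Fin (finrank ℂ E) // i ≤ j}
  let V : Submodule ℂ E := Submodule.span ℂ (Set.range fun j : J => b j)
  have hV : finrank ℂ V = finrank ℂ E - i := by
    have := finrank_span_eq_card (b := fun j : J => b j)
      (b.orthonormal.linearIndependent.comp _ Subtype.val_injective)
    rw [this, Fintype.card_subtype]
    have : (Finset.univ.filter fun j : Fin (finrank ℂ E) => i ≤ j) =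
        Finset.Ici ⟨i, hiF.trans_le hFE⟩ := by
      ext j; simp [Fin.le_def]
    rw [this, Fin.card_Ici]
  have hTV : ∀ w ∈ V, ‖T w‖ ≤ T.singularValues i * ‖w‖ := by
    intro w hw
    have hzero : ∀ j : Fin (finrank ℂ E), (j : ℕ) < i → inner ℂ (b j) w = 0 := by
      intro j hj
      have : V ≤ (ℂ ∙ b j)ᗮ := by
        rw [Submodule.span_le]
        rintro _ ⟨l, rfl⟩
        rw [SetLike.mem_coe, Submodule.mem_orthogonal_singleton_iff_inner_right]
        exact b.orthonormal.2 fun h => by have := l.2; rw [← h] at this; omega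
      exact Submodule.mem_orthogonal_singleton_iff_inner_right.1 (this hw)
    have h1 : ‖T w‖ ^ 2 = ∑ j : Fin (finrank ℂ E),
        T.singularValues j ^ 2 * ‖inner ℂ (b j) w‖ ^ 2 := by
      have : (‖T w‖ ^ 2 : ℂ) = inner ℂ w ((LinearMap.adjoint T ∘ₗ T) w) := by
        rw [LinearMap.comp_apply, LinearMap.adjoint_inner_right, inner_self_eq_norm_sq_to_K]
        rfl
      rw [← b.sum_inner_mul_inner] at this
      have h2 : ∀ j : Fin (finrank ℂ E),
          inner ℂ w (b j) * inner ℂ (b j) ((LinearMap.adjoint T ∘ₗ T) w) =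
          ((T.singularValues j ^ 2 * ‖inner ℂ (b j) w‖ ^ 2 : ℝ) : ℂ) := by
        intro j
        rw [← T.isSymmetric_adjoint_comp_self (b j) w,
          T.isSymmetric_adjoint_comp_self.apply_eigenvectorBasis, inner_smul_left,
          T.sq_singularValues_fin rfl, ← inner_conj_symm w (b j)]
        push_cast
        rw [← Complex.conj_mul']
        simp
        ring
      rw [Finset.sum_congr rfl fun j _ => h2 j] at this
      exact_mod_cast this
    have h3 : ‖w‖ ^ 2 = ∑ j, ‖inner ℂ (b j) w‖ ^ 2 := (b.sum_sq_norm_inner_right w).symm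
    have h4 : ‖T w‖ ^ 2 ≤ (T.singularValues i * ‖w‖) ^ 2 := by
      rw [h1, mul_pow, h3, Finset.mul_sum]
      refine Finset.sum_le_sum fun j _ => ?_
      rcases lt_or_ge (j : ℕ) i with hj | hj
      · rw [hzero j hj]; simp
      · have := T.singularValues_antitone hj
        have := T.singularValues_nonneg j
        gcongr
    exact le_of_sq_le_sq h4 (mul_nonneg (T.singularValues_nonneg i) (norm_nonneg w))
  have hR : finrank ℂ (LinearMap.adjoint T).range = finrank ℂ F :=
    LinearMap.finrank_range_of_inj hinj
  have hne : V ⊓ (LinearMap.adjoint T).range ≠ ⊥ := by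
    intro h
    have h1 := Submodule.finrank_sup_add_finrank_inf_eq V (LinearMap.adjoint T).range
    have h2 := Submodule.finrank_le (V ⊔ (LinearMap.adjoint T).range)
    rw [h, finrank_bot] at h1
    omega
  obtain ⟨w, ⟨hwV, u, rfl⟩, hw0⟩ := Submodule.exists_mem_ne_zero_of_ne_bot hne
  have hu : u ≠ 0 := by rintro rfl; simp at hw0
  refine ⟨u, hu, ?_⟩
  have hpos : 0 < ‖LinearMap.adjoint T u‖ := norm_pos_iff.2 hw0
  have h1 : ‖LinearMap.adjoint T u‖ ^ 2 ≤ ‖u‖ * ‖T (LinearMap.adjoint T u)‖ := by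
    have h2 : (‖LinearMap.adjoint T u‖ ^ 2 : ℂ) = inner ℂ u (T (LinearMap.adjoint T u)) := by
      rw [← LinearMap.adjoint_inner_left, inner_self_eq_norm_sq_to_K]
      rfl
    have h3 := norm_inner_le_norm (𝕜 := ℂ) u (T (LinearMap.adjoint T u))
    rw [← h2] at h3
    simpa using h3
  have h2 := hTV _ hwV
  have h3 : ‖u‖ * ‖T (LinearMap.adjoint T u)‖ ≤
      ‖u‖ * (T.singularValues i * ‖LinearMap.adjoint T u‖) := by gcongr
  refine le_of_mul_le_mul_right (a := ‖LinearMap.adjoint T u‖) ?_ hpos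
  calc _ = ‖LinearMap.adjoint T u‖ ^ 2 := by ring
    _ ≤ _ := h1.trans h3
    _ = _ := by ring

/-- In coordinates, with `u` in place of its conjugate: a unit combination of the rows of `A` is
as short as the smallest singular value. -/
lemma exists_sum_norm_sq_le_matrixSingularValue {n N : ℕ} (hn : 1 ≤ n) (hnN : n ≤ N)
    (A : Matrix (Fin n) (Fin N) ℂ) :
    ∃ u : Fin n → ℂ, ∑ i, ‖u i‖ ^ 2 = 1 ∧
      ∑ j, ‖∑ i, u i * A i j‖ ^ 2 ≤ matrixSingularValue A n ^ 2 := by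
  obtain ⟨u, hu, h⟩ := exists_norm_adjoint_le_singularValues (Matrix.toEuclideanLin A) (n - 1)
    (by rw [finrank_euclideanSpace_fin]; omega) (by simpa using hnN)
  refine ⟨fun i => star (u i), ?_, ?_⟩
  · simp only [norm_star]
    rw [← EuclideanSpace.norm_sq_eq, hu, one_pow]
  · rw [← Matrix.toEuclideanLin_conjTranspose_eq_adjoint] at h
    refine le_trans (le_of_eq ?_) (pow_le_pow_left₀ (norm_nonneg _) h 2)
    rw [EuclideanSpace.norm_sq_eq]
    refine Finset.sum_congr rfl fun j _ => ?_
    rw [← norm_star]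
    simp [Matrix.toLpLin_apply, Matrix.mulVec, dotProduct, mul_comm]

end SingularValues

/-! ### Nearly singular Gaussian matrices -/

section SmallestSingularValue

open Matrix

variable {ι κ : Type*} [Fintype ι] [Fintype κ]

lemma isClosed_setOf_exists_unit {Z : Type*} [TopologicalSpace Z] {C : Set ((ι → ℂ) × Z)}
    (hC : IsClosed C) : IsClosed {z : Z | ∃ u : ι → ℂ, ∑ i, ‖u i‖ ^ 2 = 1 ∧ (u, z) ∈ C} := by
  have hK : IsCompact {u : ι → ℂ | ∑ i, ‖u i‖ ^ 2 = 1} := by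
    refine (isCompact_closedBall (0 : ι → ℂ) 1).of_isClosed_subset
      (isClosed_eq (by fun_prop) (by fun_prop)) fun u hu => ?_
    rw [mem_closedBall_zero_iff, pi_norm_le_iff_of_nonneg zero_le_one]
    intro i
    have h := Finset.single_le_sum (f := fun i => ‖u i‖ ^ 2) (fun i _ => by positivity)
      (Finset.mem_univ i)
    rw [Set.mem_ofPred_eq] at hu
    rw [hu] at h
    exact (sq_le_one_iff₀ (norm_nonneg _)).1 h
  have := isCompact_iff_compactSpace.1 hK
  convert isClosedMap_snd_of_compactSpace (X := {u : ι → ℂ | ∑ i, ‖u i‖ ^ 2 = 1}) _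
    (hC.preimage (by fun_prop : Continuous fun p : {u : ι → ℂ | ∑ i, ‖u i‖ ^ 2 = 1} × Z =>
      ((p.1 : ι → ℂ), p.2))) using 1
  ext z
  simp only [Set.mem_ofPred_eq, Set.mem_image, Set.mem_preimage, Prod.exists, Subtype.exists,
    exists_eq_right, exists_prop]

lemma ae_ne_zero_pi_complexGaussian [Nonempty ι] {v : ℝ≥0} (hv : v ≠ 0) :
    ∀ᵐ g ∂(Measure.pi fun _ : ι => complexGaussian v), g ≠ 0 := by
  rw [pi_complexGaussian_eq_withDensity hv]
  refine (withDensity_absolutelyContinuous _ _).ae_le ?_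
  exact compl_mem_ae_iff.2 (measure_singleton 0)

variable [DecidableEq ι]

/-- If a unit combination of rows is short and the row `i₀` has a large coefficient, then that row
is close to the span of the other ones. Given the other rows, this has small probability. -/
lemma pi_complexGaussian_large_coeff_le (i₀ : ι) (D : Matrix ι κ ℂ) {v : ℝ≥0} (hv : v ≠ 0)
    {k : ℕ} (hk0 : k ≠ 0) (hk : Fintype.card ι + k ≤ Fintype.card κ + 1) {α ρ : ℝ} (hα : 0 < α)
    (hρ : 0 ≤ ρ) :
    Measure.pi (fun _ : ι × κ => complexGaussian v)
        {A | ∃ u : ι → ℂ, ∑ i, ‖u i‖ ^ 2 = 1 ∧ α ≤ ‖u i₀‖ ^ 2 ∧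
          ∑ j, ‖∑ i, u i * (D i j + A (i, j))‖ ^ 2 ≤ ρ} ≤
      ENNReal.ofReal ((ρ / α / v) ^ k / k.factorial) := by
  classical
  set S := {A : ι × κ → ℂ | ∃ u : ι → ℂ, ∑ i, ‖u i‖ ^ 2 = 1 ∧ α ≤ ‖u i₀‖ ^ 2 ∧
          ∑ j, ‖∑ i, u i * (D i j + A (i, j))‖ ^ 2 ≤ ρ} with hS
  have hSm : MeasurableSet S := by
    refine (isClosed_setOf_exists_unit (C := {p : (ι → ℂ) × (ι × κ → ℂ) | α ≤ ‖p.1 i₀‖ ^ 2 ∧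
      ∑ j, ‖∑ i, p.1 i * (D i j + p.2 (i, j))‖ ^ 2 ≤ ρ}) ?_).measurableSet
    rw [Set.ofPred_and]
    exact (isClosed_le (by fun_prop) (by fun_prop)).inter
      (isClosed_le (by fun_prop) (by fun_prop))
  have hmp := (measurePreserving_piEquivPiSubtypeProd (fun _ : ι × κ => complexGaussian v)
    (fun p => p.1 = i₀)).symm
  rw [← hmp.measure_preimage hSm.nullMeasurableSet,
    Measure.prod_apply_symm (MeasurableEquiv.measurable _ hSm)]
  refine le_trans (lintegral_mono (g := fun _ => ENNReal.ofReal ((ρ / α / v) ^ k / k.factorial))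
    fun y => ?_) (by simp)
  let e : κ ≃ {p : ι × κ // p.1 = i₀} :=
    { toFun := fun j => ⟨(i₀, j), rfl⟩
      invFun := fun p => p.1.2
      left_inv := fun _ => rfl
      right_inv := fun p => Subtype.ext (Prod.ext p.2.symm rfl) }
  have hcard : Fintype.card {i // i ≠ i₀} + k ≤ Fintype.card {p : ι × κ // p.1 = i₀} := by
    have hpos : 0 < Fintype.card ι := Fintype.card_pos_iff.2 ⟨i₀⟩
    rw [← Fintype.card_congr e, Fintype.card_subtype_compl, Fintype.card_subtype_eq]
    omega
  have h := pi_complexGaussian_near_span_le hv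
    (fun (l : {i // i ≠ i₀}) (p : {p : ι × κ // p.1 = i₀}) =>
      D l p.1.2 + y ⟨(l.1, p.1.2), l.2⟩) hk0 hcard
    (fun p => D i₀ p.1.2) (div_nonneg hρ hα.le)
  refine le_trans (measure_mono ?_) h
  rintro x ⟨u, -, hu, hle⟩
  have hu0 : u i₀ ≠ 0 := by
    intro h0
    rw [h0] at hu
    simp at hu
    linarith
  refine ⟨fun l => u l / u i₀, ?_⟩
  rw [← e.sum_comp, le_div_iff₀ hα]
  refine le_trans (mul_le_mul_of_nonneg_left hu (Finset.sum_nonneg fun _ _ => by positivity)) ?_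
  refine le_trans (le_of_eq ?_) hle
  rw [Finset.sum_mul]
  refine Finset.sum_congr rfl fun j _ => ?_
  rw [← mul_pow, ← norm_mul]
  congr 2
  rw [Fintype.sum_eq_add_sum_subtype_ne _ i₀, add_mul, Finset.sum_mul]
  congr 1
  · simp [e, MeasurableEquiv.piEquivPiSubtypeProd, Equiv.piEquivPiSubtypeProd, mul_comm]
  · refine Finset.sum_congr rfl fun l _ => ?_
    simp [e, MeasurableEquiv.piEquivPiSubtypeProd, Equiv.piEquivPiSubtypeProd, l.2]
    field_simp

/-- The same for the component of the coefficient vector along any fixed direction: a unitary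
matrix acting on the rows moves that direction to a coordinate axis. -/
lemma pi_complexGaussian_large_component_le (D : Matrix ι κ ℂ) {v : ℝ≥0} (hv : v ≠ 0)
    {k : ℕ} (hk0 : k ≠ 0) (hk : Fintype.card ι + k ≤ Fintype.card κ + 1) {α ρ : ℝ} (hα : 0 < α)
    (hρ : 0 ≤ ρ) {g : ι → ℂ} (hg : g ≠ 0) :
    Measure.pi (fun _ : ι × κ => complexGaussian v)
        {A | ∃ u : ι → ℂ, ∑ i, ‖u i‖ ^ 2 = 1 ∧
          α * ∑ i, ‖g i‖ ^ 2 ≤ ‖∑ i, u i * g i‖ ^ 2 ∧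
          ∑ j, ‖∑ i, u i * (D i j + A (i, j))‖ ^ 2 ≤ ρ} ≤
      ENNReal.ofReal ((ρ / α / v) ^ k / k.factorial) := by
  obtain ⟨i₀, hi₀⟩ := Function.ne_iff.1 hg
  set s := ∑ i, ‖g i‖ ^ 2 with hs
  have hspos : 0 < s := Finset.sum_pos' (fun _ _ => by positivity)
    ⟨i₀, Finset.mem_univ _, by have := norm_pos_iff.2 hi₀; positivity⟩
  have hsq : ‖((√s : ℝ) : ℂ)‖ ^ 2 = s := by
    rw [Complex.norm_real, Real.norm_of_nonneg (Real.sqrt_nonneg s), Real.sq_sqrt hspos.le]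
  obtain ⟨W, hW, hWg⟩ := exists_unitary_row i₀ (fun i => star (g i) / (√s : ℝ)) (by
    simp only [norm_div, norm_star, div_pow, hsq]
    rw [← Finset.sum_div, ← hs, div_self hspos.ne'])
  have h := pi_complexGaussian_large_coeff_le i₀ (W * D) hv hk0 hk hα hρ
  refine le_trans ?_ h
  refine le_trans (measure_mono ?_)
    ((measurePreserving_mul_pi_complexGaussian (κ := κ) hv hW).measure_preimage_le _)
  rintro A ⟨u, hu1, hu2, hu3⟩
  have hstar : u ᵥ* star W = star (W *ᵥ star u) := by
    rw [star_mulVec, star_star, star_eq_conjTranspose]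
  refine ⟨u ᵥ* star W, ?_, ?_, ?_⟩
  · have h1 := sum_norm_sq_mulVec_of_mem_unitaryGroup hW (star u)
    simp only [Pi.star_apply, norm_star] at h1
    simp only [hstar, Pi.star_apply, norm_star]
    rw [h1, hu1]
  · have h1 : (u ᵥ* star W) i₀ = (∑ i, u i * g i) / (√s : ℝ) := by
      simp [vecMul, dotProduct, star_apply, hWg, Finset.sum_div, mul_div_assoc]
    rw [h1, norm_div, div_pow, hsq, le_div_iff₀ hspos]
    exact hu2
  · refine le_trans (le_of_eq ?_) hu3
    refine Finset.sum_congr rfl fun j _ => ?_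
    have h1 : (u ᵥ* star W) ᵥ* (W * (D + Matrix.of fun i j => A (i, j))) =
        u ᵥ* (D + Matrix.of fun i j => A (i, j)) := by
      rw [vecMul_vecMul, ← Matrix.mul_assoc, mem_unitaryGroup_iff'.1 hW, Matrix.one_mul]
    have h2 := congrArg (fun x => ‖x j‖ ^ 2) h1
    rw [Matrix.mul_add] at h2
    exact h2

/-- A Gaussian direction has squared component at least `α` along any fixed unit vector with
probability at least `(1 - α) ^ (n - 1)`, where `n = card ι`. -/
lemma ofReal_le_pi_complexGaussian_component {v : ℝ≥0} (hv : v ≠ 0) {α : ℝ} (hα : 0 ≤ α)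
    (hα1 : α < 1) {u : ι → ℂ} (hu : ∑ i, ‖u i‖ ^ 2 = 1) :
    ENNReal.ofReal ((1 - α) ^ (Fintype.card ι - 1)) ≤
      Measure.pi (fun _ : ι => complexGaussian v)
        {g | α * ∑ i, ‖g i‖ ^ 2 ≤ ‖∑ i, u i * g i‖ ^ 2} := by
  have h1α : 0 < 1 - α := by linarith
  obtain ⟨i₀⟩ : Nonempty ι := by
    by_contra hne
    rw [not_nonempty_iff] at hne
    simp at hu
  obtain ⟨W, hW, hWu⟩ := exists_unitary_row i₀ u hu
  set T := {h : ι → ℂ | α * ∑ i, ‖h i‖ ^ 2 ≤ ‖h i₀‖ ^ 2}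
  have hTm : MeasurableSet T := measurableSet_le (by fun_prop) (by fun_prop)
  have hpre : {g : ι → ℂ | α * ∑ i, ‖g i‖ ^ 2 ≤ ‖∑ i, u i * g i‖ ^ 2} =
      (fun x => W *ᵥ x) ⁻¹' T := by
    ext g
    simp only [T, Set.mem_ofPred_eq, Set.mem_preimage, sum_norm_sq_mulVec_of_mem_unitaryGroup hW]
    simp [mulVec, dotProduct, hWu]
  have hmp := (measurePreserving_piEquivPiSubtypeProd (fun _ : ι => complexGaussian v)
    (fun i => i = i₀)).symm
  rw [hpre, (measurePreserving_mulVec_pi_complexGaussian hv hW).measure_preimage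
    hTm.nullMeasurableSet, ← hmp.measure_preimage hTm.nullMeasurableSet,
    Measure.prod_apply_symm (MeasurableEquiv.measurable _ hTm)]
  -- `α (|h₀|² + S) ≤ |h₀|²` is `β S ≤ |h₀|²`, which has probability `exp (-β S / v)` given `S`
  set β : ℝ≥0 := ⟨α / (1 - α), by positivity⟩
  have hβ : (β : ℝ) = α / (1 - α) := rfl
  have hcard : Fintype.card {i // ¬ i = i₀} = Fintype.card ι - 1 := by
    rw [Fintype.card_subtype_compl, Fintype.card_subtype_eq]
  have hL := lintegral_exp_pi_complexGaussian (ι := {i // ¬ i = i₀}) hv β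
  have hβ' : (1 + β : ℝ)⁻¹ = 1 - α := by rw [hβ]; field_simp; ring
  rw [hcard, hβ'] at hL
  rw [← hL]
  refine lintegral_mono fun y => ?_
  refine le_trans (ofReal_exp_le_complexGaussian hv (by positivity)) ?_
  have hev := measurePreserving_eval (fun _ : {i // i = i₀} => complexGaussian v) ⟨i₀, rfl⟩
  rw [Subsingleton.elim (Fintype.subtypeEq i₀) (Subtype.fintype fun i => i = i₀)] at hev
  have hms : MeasurableSet {z : ℂ | β * ∑ l, ‖y l‖ ^ 2 ≤ ‖z‖ ^ 2} :=
    measurableSet_le (by fun_prop) (by fun_prop)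
  rw [← hev.measure_preimage hms.nullMeasurableSet]
  refine measure_mono fun x hx => ?_
  simp only [Set.mem_preimage, Set.mem_ofPred_eq, Function.eval, hβ] at hx
  simp only [Set.mem_preimage, Set.mem_ofPred_eq, T]
  rw [Fintype.sum_eq_add_sum_subtype_ne _ i₀]
  have e1 : ((MeasurableEquiv.piEquivPiSubtypeProd (fun _ : ι => ℂ) (fun i => i = i₀)).symm (x, y))
      i₀ = x ⟨i₀, rfl⟩ := by
    simp [MeasurableEquiv.piEquivPiSubtypeProd, Equiv.piEquivPiSubtypeProd]
  have e2 : ∀ l : {i // i ≠ i₀},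
      ((MeasurableEquiv.piEquivPiSubtypeProd (fun _ : ι => ℂ) (fun i => i = i₀)).symm (x, y))
      l = y l := by
    intro l
    simp [MeasurableEquiv.piEquivPiSubtypeProd, Equiv.piEquivPiSubtypeProd, l.2]
  simp only [e1, e2]
  rw [div_mul_eq_mul_div, div_le_iff₀ h1α] at hx
  linarith

/-- Averaging over a Gaussian direction `g`, independent of `A`: the unit vector `u` witnessing
that `D + A` is nearly singular depends on `A` only, so it has a large component along `g` with
probability at least `(1 - α) ^ (n - 1)`, while for each `g` this is an unlikely event. -/
lemma pi_complexGaussian_exists_unit_le [Nonempty ι] (D : Matrix ι κ ℂ) {v : ℝ≥0} (hv : v ≠ 0)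
    {k : ℕ} (hk0 : k ≠ 0) (hk : Fintype.card ι + k ≤ Fintype.card κ + 1) {α ρ : ℝ} (hα : 0 < α)
    (hα1 : α < 1) (hρ : 0 ≤ ρ) :
    ENNReal.ofReal ((1 - α) ^ (Fintype.card ι - 1)) *
      Measure.pi (fun _ : ι × κ => complexGaussian v)
        {A | ∃ u : ι → ℂ, ∑ i, ‖u i‖ ^ 2 = 1 ∧
          ∑ j, ‖∑ i, u i * (D i j + A (i, j))‖ ^ 2 ≤ ρ} ≤
      ENNReal.ofReal ((ρ / α / v) ^ k / k.factorial) := by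
  set B := {A : ι × κ → ℂ | ∃ u : ι → ℂ, ∑ i, ‖u i‖ ^ 2 = 1 ∧
          ∑ j, ‖∑ i, u i * (D i j + A (i, j))‖ ^ 2 ≤ ρ}
  have hBm : MeasurableSet B := (isClosed_setOf_exists_unit
    (C := {p : (ι → ℂ) × (ι × κ → ℂ) | ∑ j, ‖∑ i, p.1 i * (D i j + p.2 (i, j))‖ ^ 2 ≤ ρ})
    (isClosed_le (by fun_prop) (by fun_prop))).measurableSet
  set S := {q : (ι × κ → ℂ) × (ι → ℂ) | ∃ u : ι → ℂ, ∑ i, ‖u i‖ ^ 2 = 1 ∧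
          α * ∑ i, ‖q.2 i‖ ^ 2 ≤ ‖∑ i, u i * q.2 i‖ ^ 2 ∧
          ∑ j, ‖∑ i, u i * (D i j + q.1 (i, j))‖ ^ 2 ≤ ρ}
  have hSm : MeasurableSet S := (isClosed_setOf_exists_unit
    (C := {p : (ι → ℂ) × (ι × κ → ℂ) × (ι → ℂ) |
      α * ∑ i, ‖p.2.2 i‖ ^ 2 ≤ ‖∑ i, p.1 i * p.2.2 i‖ ^ 2 ∧
      ∑ j, ‖∑ i, p.1 i * (D i j + p.2.1 (i, j))‖ ^ 2 ≤ ρ})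
    (by
      rw [Set.ofPred_and]
      exact (isClosed_le (by fun_prop) (by fun_prop)).inter
        (isClosed_le (by fun_prop) (by fun_prop)))).measurableSet
  calc _ = ∫⁻ A, B.indicator (fun _ => ENNReal.ofReal ((1 - α) ^ (Fintype.card ι - 1))) A
        ∂(Measure.pi fun _ : ι × κ => complexGaussian v) := by
        rw [lintegral_indicator_const hBm]
    _ ≤ ((Measure.pi fun _ : ι × κ => complexGaussian v).prod
          (Measure.pi fun _ : ι => complexGaussian v)) S := by
        rw [Measure.prod_apply hSm]
        refine lintegral_mono fun A => Set.indicator_apply_le' (fun hA => ?_) (fun _ => zero_le)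
        obtain ⟨u, hu1, hu2⟩ := hA
        exact (ofReal_le_pi_complexGaussian_component hv hα.le hα1 hu1).trans
          (measure_mono fun g hg => ⟨u, hu1, hg, hu2⟩)
    _ ≤ ∫⁻ _, ENNReal.ofReal ((ρ / α / v) ^ k / k.factorial)
          ∂(Measure.pi fun _ : ι => complexGaussian v) := by
        rw [Measure.prod_apply_symm hSm]
        refine lintegral_mono_ae ?_
        filter_upwards [ae_ne_zero_pi_complexGaussian hv] with g hg
        exact pi_complexGaussian_large_component_le D hv hk0 hk hα hρ hg
    _ = _ := by simp

end SmallestSingularValue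

/-! ### Optimizing the bound -/

/-- A bound on `(1 - α) ^ m` at the point `α = k / (m + k)`, where `α ^ k * (1 - α) ^ m` is
largest. -/
lemma exp_neg_le_one_sub_pow (m k : ℕ) :
    Real.exp (-k) ≤ (1 - (k : ℝ) / (m + k)) ^ m := by
  rcases Nat.eq_zero_or_pos m with rfl | hm
  · simp
  have hm' : (0 : ℝ) < m := by exact_mod_cast hm
  have hpos : (0 : ℝ) < m + k := by positivity
  have h1 : 1 - (k : ℝ) / (m + k) = (1 + (k : ℝ) / m)⁻¹ := by field_simp; ring
  rw [h1, inv_pow, Real.exp_neg]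
  refine inv_anti₀ (by positivity) ?_
  calc (1 + (k : ℝ) / m) ^ m ≤ Real.exp (k / m) ^ m := by
        refine pow_le_pow_left₀ (by positivity) ?_ m
        rw [add_comm]; exact Real.add_one_le_exp _
    _ = Real.exp k := by
        rw [← Real.exp_nat_mul]; congr 1; field_simp

/-- This is Stirling's lower bound `√(2 π k) (k / e) ^ k ≤ k!`. -/
lemma exp_pow_mul_div_factorial_le {k : ℕ} (hk : k ≠ 0) {x : ℝ} (hx : 0 ≤ x) :
    Real.exp k * (x / k) ^ k / k.factorial ≤
      x ^ k / √(2 * Real.pi) * ((Real.exp 1 ^ 2) ^ k / (k : ℝ) ^ (2 * (k : ℝ) + 1 / 2)) := by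
  have hk' : (0 : ℝ) < k := by positivity
  have hS := Stirling.le_factorial_stirling k
  have hr : (k : ℝ) ^ (2 * (k : ℝ) + 1 / 2) = (k : ℝ) ^ k * (k : ℝ) ^ k * √k := by
    rw [Real.rpow_add hk', two_mul, Real.rpow_add hk', Real.rpow_natCast, Real.sqrt_eq_rpow]
  rw [Real.sqrt_mul (by positivity)] at hS
  rw [hr]
  have he : Real.exp k = Real.exp 1 ^ k := by rw [← Real.exp_nat_mul, mul_one]
  calc Real.exp k * (x / k) ^ k / k.factorial
      ≤ Real.exp k * (x / k) ^ k / (√(2 * Real.pi) * √k * (k / Real.exp 1) ^ k) := by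
        gcongr
    _ = _ := by
        rw [he, div_pow, div_pow]
        field_simp
        ring

theorem theoremA1 {Ω : Type*} [MeasurableSpace Ω] (P : Measure Ω) [IsProbabilityMeasure P]
    (n N : ℕ) (hn : 1 ≤ n) (hnN : n ≤ N)
    (R_D : Matrix (Fin n) (Fin N) ℂ)
    (G : Ω → Matrix (Fin n) (Fin N) ℂ)
    (hG_law : ∀ (i : Fin n) (j : Fin N),
      HasLaw (fun ω => G ω i j) (complexGaussian (n : ℝ≥0)⁻¹) P)
    (hG_indep : iIndepFun (fun (ij : Fin n × Fin N) (ω : Ω) => G ω ij.1 ij.2) P)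
    (τ : ℝ) (hτ : 0 < τ) :
    P.real {ω | matrixSingularValue (R_D + G ω) n ≤ τ} ≤
      τ ^ (2 * (N - n + 1)) / Real.sqrt (2 * Real.pi) *
        (((n : ℝ) * (N : ℝ) * Real.exp 1 ^ 2) ^ (N - n + 1) /
          ((N : ℝ) - (n : ℝ) + 1) ^ (2 * ((N : ℝ) - (n : ℝ) + 1) + 1 / 2)) := by
  obtain ⟨k, hk⟩ : ∃ k, k = N - n + 1 := ⟨_, rfl⟩
  have hk0 : k ≠ 0 := by omega
  have hkR : (N : ℝ) - n + 1 = k := by rw [hk]; push_cast [hnN]; ring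
  rw [hkR, ← hk]
  have hk' : (0 : ℝ) < k := by positivity
  have hn' : (0 : ℝ) < n := by exact_mod_cast hn
  have hN' : (0 : ℝ) < N := by exact_mod_cast hn.trans hnN
  have : Nonempty (Fin n) := ⟨⟨0, hn⟩⟩
  have hv : (n : ℝ≥0)⁻¹ ≠ 0 := inv_ne_zero (by exact_mod_cast (by omega : n ≠ 0))
  set p := P.real {ω | matrixSingularValue (R_D + G ω) n ≤ τ} with hp
  set B := {A : Fin n × Fin N → ℂ | ∃ u : Fin n → ℂ, ∑ i, ‖u i‖ ^ 2 = 1 ∧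
    ∑ j, ‖∑ i, u i * (R_D i j + A (i, j))‖ ^ 2 ≤ τ ^ 2}
  have hlaw : HasLaw (fun ω (ij : Fin n × Fin N) => G ω ij.1 ij.2)
      (Measure.pi fun _ => complexGaussian (n : ℝ≥0)⁻¹) P :=
    iIndepFun.hasLaw_pi (fun ij => hG_law ij.1 ij.2) hG_indep
  have hpB : P {ω | matrixSingularValue (R_D + G ω) n ≤ τ} ≤
      Measure.pi (fun _ => complexGaussian (n : ℝ≥0)⁻¹) B := by
    rw [← hlaw.map_eq]
    refine le_trans (measure_mono fun ω hω => ?_) (Measure.le_map_apply hlaw.aemeasurable B)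
    obtain ⟨u, hu1, hu2⟩ := exists_sum_norm_sq_le_matrixSingularValue hn hnN (R_D + G ω)
    exact ⟨u, hu1, hu2.trans
      (pow_le_pow_left₀ (LinearMap.singularValues_nonneg _ _) hω 2)⟩
  have hmain : ∀ α ∈ Set.Ioo (0 : ℝ) 1,
      α ^ k * (1 - α) ^ (n - 1) * p ≤ (τ ^ 2 * n) ^ k / k.factorial := by
    rintro α ⟨hα, hα1⟩
    have h := pi_complexGaussian_exists_unit_le R_D hv hk0 (by simp; omega) hα hα1
      (sq_nonneg τ)
    have h1α : 0 < 1 - α := by linarith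
    rw [Fintype.card_fin] at h
    have h2 := (mul_le_mul_right hpB _).trans h
    rw [← ofReal_measureReal, ← ENNReal.ofReal_mul (by positivity),
      ENNReal.ofReal_le_ofReal_iff (by positivity)] at h2
    calc α ^ k * (1 - α) ^ (n - 1) * p = α ^ k * ((1 - α) ^ (n - 1) * p) := by ring
      _ ≤ α ^ k * ((τ ^ 2 / α / ((n : ℝ≥0)⁻¹ : ℝ≥0)) ^ k / k.factorial) := by gcongr
      _ = _ := by
        rw [← mul_div_assoc, ← mul_pow]
        congr 2
        push_cast
        field_simp
  -- for `n = 1` the optimal `α` is `1`, so the bound is extended to the closed interval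
  have hclosed : ∀ α ∈ Set.Icc (0 : ℝ) 1,
      α ^ k * (1 - α) ^ (n - 1) * p ≤ (τ ^ 2 * n) ^ k / k.factorial := by
    rw [← closure_Ioo zero_ne_one]
    have hc : IsClosed {α : ℝ | α ^ k * (1 - α) ^ (n - 1) * p ≤ (τ ^ 2 * n) ^ k / k.factorial} :=
      isClosed_le (by fun_prop) (by fun_prop)
    exact hc.closure_subset_iff.2 hmain
  have hNk : ((n - 1 : ℕ) : ℝ) + k = N := by
    rw [← Nat.cast_add]; congr 1; omega
  have hkN : (k : ℝ) ≤ N := by rw [← hNk]; simp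
  have h1 := hclosed (k / N) ⟨by positivity, (div_le_one hN').2 hkN⟩
  have h2 := exp_neg_le_one_sub_pow (n - 1) k
  rw [hNk] at h2
  have hp0 : 0 ≤ p := measureReal_nonneg
  have h3 : (k / N : ℝ) ^ k * Real.exp (-k) * p ≤ (τ ^ 2 * n) ^ k / k.factorial :=
    le_trans (by gcongr) h1
  have h4 : p ≤ Real.exp k * (τ ^ 2 * n * N / k) ^ k / k.factorial := by
    have h5 : p = (Real.exp k * (N / k : ℝ) ^ k) * ((k / N : ℝ) ^ k * Real.exp (-k) * p) := by
      rw [Real.exp_neg, div_pow, div_pow]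
      field_simp
    rw [h5]
    refine (mul_le_mul_of_nonneg_left h3 (by positivity)).trans (le_of_eq ?_)
    rw [mul_div_assoc (τ ^ 2 * n), mul_pow _ ((N : ℝ) / k)]
    ring
  refine h4.trans ((exp_pow_mul_div_factorial_le hk0 (by positivity)).trans (le_of_eq ?_))
  rw [pow_mul, mul_pow (n * N : ℝ), mul_assoc (τ ^ 2), mul_pow (τ ^ 2)]
  ring
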